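/- Let $\Gamma$ and $\Lambda$ be arbitrary lattices in $\mathbb{R}^d$ (discrete subgroups of finite covolume), let $N \ge 1$, let $\gamma_1,\dots,\gamma_N$ be distinct elements of $\Gamma$, and let $\psi_1,\dots,\psi_N \in L^\infty(\mathbb{R}^d/\Lambda)$ be complex-valued and nonzero Lebesgue-almost everywhere, viewed as $\Lambda$-periodic functions on $\mathbb{R}^d$. Let $0 < p \le 2$, and let $S$ be the linear operator on the space $L^p(\mathbb{R}^d)$ of complex-valued functions defined by $$Sf(x) = \sum_{k=1}^N \psi_k(x)\, f(x+\gamma_k).$$ Then $\ker(S) = \{0\}$; that is, if $f \in L^p(\mathbb{R}^d)$ and $Sf = 0$ almost everywhere, then $f = 0$ almost everywhere. -/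

import Mathlib

open MeasureTheory
open scoped ENNReal

noncomputable section

/-- The translation operator `f ↦ f(· + v)` on the complex space `L^p(ℝ^d)`, for every exponent
`p` (including `0 < p < 1`). -/
def translateLp {d : ℕ} (p : ℝ≥0∞) (v : EuclideanSpace ℝ (Fin d)) :
    Lp ℂ p (volume : Measure (EuclideanSpace ℝ (Fin d))) →ₗ[ℂ]
      Lp ℂ p (volume : Measure (EuclideanSpace ℝ (Fin d))) :=
  Lp.compMeasurePreservingₗ ℂ (fun x => x + v) (measurePreserving_add_right volume v)

theorem coeFn_translateLp {d : ℕ} (p : ℝ≥0∞) (v : EuclideanSpace ℝ (Fin d))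
    (f : Lp ℂ p (volume : Measure (EuclideanSpace ℝ (Fin d)))) :
    translateLp p v f =ᵐ[volume] fun x => f (x + v) :=
  Lp.coeFn_compMeasurePreserving f (measurePreserving_add_right volume v)

/-- `L^∞(ℝ^d / Λ)`, viewed as the space of `Λ`-periodic elements of `L^∞(ℝ^d)`: the classes `ψ` of
essentially bounded functions such that `ψ(· + v) = ψ` almost everywhere for each `v ∈ Λ`. -/
def periodicLinfty {d : ℕ} (Λ : Submodule ℤ (EuclideanSpace ℝ (Fin d))) :
    Submodule ℂ (Lp ℂ ∞ (volume : Measure (EuclideanSpace ℝ (Fin d)))) where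
  carrier := {ψ | ∀ v ∈ Λ, translateLp ∞ v ψ = ψ}
  add_mem' := by
    intro a b ha hb v hv
    rw [map_add, ha v hv, hb v hv]
  zero_mem' := by
    intro v _
    exact map_zero _
  smul_mem' := by
    intro c a ha v hv
    rw [map_smul, ha v hv]

/-- Multiplication by `ψ ∈ L^∞(ℝ^d)`, as a linear operator on the complex space `L^p(ℝ^d)`. -/
def multiplyLp {d : ℕ} (p : ℝ≥0∞) (ψ : Lp ℂ ∞ (volume : Measure (EuclideanSpace ℝ (Fin d)))) :
    Lp ℂ p (volume : Measure (EuclideanSpace ℝ (Fin d))) →ₗ[ℂ]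
      Lp ℂ p (volume : Measure (EuclideanSpace ℝ (Fin d))) :=
  (ContinuousLinearMap.mul ℂ ℂ).holderₗ volume ∞ p p ψ

theorem coeFn_multiplyLp {d : ℕ} (p : ℝ≥0∞)
    (ψ : Lp ℂ ∞ (volume : Measure (EuclideanSpace ℝ (Fin d))))
    (f : Lp ℂ p (volume : Measure (EuclideanSpace ℝ (Fin d)))) :
    multiplyLp p ψ f =ᵐ[volume] fun x => ψ x * f x :=
  (ContinuousLinearMap.mul ℂ ℂ).coeFn_holder ψ f

/-- The operator `S f(x) = ∑ k, ψ k (x) * f (x + γ k)` on `L^p(ℝ^d)`. -/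
def latticeOp {d N : ℕ} (p : ℝ≥0∞) (γ : Fin N → EuclideanSpace ℝ (Fin d))
    (ψ : Fin N → Lp ℂ ∞ (volume : Measure (EuclideanSpace ℝ (Fin d)))) :
    Lp ℂ p (volume : Measure (EuclideanSpace ℝ (Fin d))) →ₗ[ℂ]
      Lp ℂ p (volume : Measure (EuclideanSpace ℝ (Fin d))) :=
  ∑ k, multiplyLp p (ψ k) ∘ₗ translateLp p (γ k)

theorem coeFn_latticeOp {d N : ℕ} (p : ℝ≥0∞) (γ : Fin N → EuclideanSpace ℝ (Fin d))
    (ψ : Fin N → Lp ℂ ∞ (volume : Measure (EuclideanSpace ℝ (Fin d))))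
    (f : Lp ℂ p (volume : Measure (EuclideanSpace ℝ (Fin d)))) :
    latticeOp p γ ψ f =ᵐ[volume] fun x => ∑ k, ψ k x * f (x + γ k) := by
  have h1 : ⇑(latticeOp p γ ψ f) =ᵐ[volume]
      fun x => ∑ k, multiplyLp p (ψ k) (translateLp p (γ k) f) x := by
    simp only [latticeOp, LinearMap.sum_apply, LinearMap.comp_apply]
    exact Lp.coeFn_fun_finsetSum _ _
  have h2 : ∀ᵐ x ∂volume, ∀ k, multiplyLp p (ψ k) (translateLp p (γ k) f) x =
      ψ k x * f (x + γ k) := by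
    rw [ae_all_iff]
    intro k
    filter_upwards [coeFn_multiplyLp p (ψ k) (translateLp p (γ k) f),
      coeFn_translateLp p (γ k) f] with x hx hy
    rw [hx, hy]
  filter_upwards [h1, h2] with x hx hy
  rw [hx]
  exact Finset.sum_congr rfl fun k _ => hy k

end

/-! Fix x. Since the ψ_k are Λ-periodic, for every v ∈ Λ the function g ↦ f(x + v + g) on Γ solves
one and the same difference equation, with coefficients ψ_k(x + g); as p ≤ 2, it is square-summable
for almost every x. Square-summable solutions have zero dimension per lattice point. Solving for an
extreme translate shows that a solution vanishing on the boundary C of a Følner set B vanishes on B,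
so the evaluations at points of B have squared norms on the solution space summing to at most #C ≤ ε
#B (`exists_sum_le_card_boundary`, `exists_folner`). These norms bound the relative mass |f|² / ∑
|f|² for all v at once, hence also its supremum over v (`maxRelMass`), which is Λ-periodic.
Translation preserves the integral of a periodic function over a fundamental domain of Λ, so
averaging over B bounds that integral by ε times the volume (`ae_eq_zero_of_periodic_of_sum_le`).
The relative mass is therefore zero, and so is f. -/

/-! ### Evaluation functionals and boundary values -/

/-- If finitely many functionals `e i`, `i ∈ B`, satisfying Bessel's inequality are determined by
those with `i ∈ C`, then the squared norms of the `e i` over `B` sum to at most `#C`. -/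
theorem exists_sum_le_card_of_determined {ι H : Type*} [NormedAddCommGroup H]
    [InnerProductSpace ℂ H] [CompleteSpace H] (e : ι → H →L[ℂ] ℂ) (B C : Finset ι)
    (hbessel : ∀ v, ∑ i ∈ B, ‖e i v‖ ^ 2 ≤ ‖v‖ ^ 2)
    (hdet : ∀ v, (∀ i ∈ C, e i v = 0) → ∀ i ∈ B, e i v = 0) :
    ∃ c : ι → ℝ, (∀ i, 0 ≤ c i) ∧ ∑ i ∈ B, c i ≤ C.card ∧
      ∀ i ∈ B, ∀ v, ‖e i v‖ ^ 2 ≤ c i * ‖v‖ ^ 2 := by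
  let R : H →L[ℂ] (C → ℂ) := ContinuousLinearMap.pi fun i => e i
  let W₀ : Submodule ℂ H := LinearMap.ker (R : H →ₗ[ℂ] (C → ℂ))
  have hW₀ : IsClosed (W₀ : Set H) := R.isClosed_ker
  have : CompleteSpace W₀ := hW₀.completeSpace_coe
  -- A vector of W₀ᗮ killed by all `e i`, `i ∈ C`, is orthogonal to itself; hence W₀ᗮ has dimension
  -- at most #C.
  have hinj : Function.Injective ((R : H →ₗ[ℂ] (C → ℂ)).domRestrict W₀ᗮ) := by
    rw [← LinearMap.ker_eq_bot, LinearMap.ker_eq_bot']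
    intro w hw
    have h0 : (w : H) ∈ W₀ := hw
    have := W₀.inner_right_of_mem_orthogonal h0 w.2
    exact Subtype.ext (inner_self_eq_zero.1 this)
  have : FiniteDimensional ℂ W₀ᗮ := Module.Finite.of_injective _ hinj
  have hdim : Module.finrank ℂ W₀ᗮ ≤ C.card := by
    simpa using LinearMap.finrank_le_finrank_of_injective hinj
  let w := stdOrthonormalBasis ℂ W₀ᗮ
  -- This is the squared norm of `e i` on W₀ᗮ. Summed over B, each basis vector contributes at most
  -- 1 by Bessel.
  refine ⟨fun i => ∑ j, ‖e i (w j)‖ ^ 2, fun i => by positivity, ?_, fun i hi v => ?_⟩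
  · rw [Finset.sum_comm]
    calc ∑ j, ∑ i ∈ B, ‖e i (w j)‖ ^ 2 ≤ ∑ j, (1 : ℝ) := by
          refine Finset.sum_le_sum fun j _ => (hbessel _).trans ?_
          have : ‖(w j : H)‖ = 1 := w.orthonormal.1 j
          rw [this, one_pow]
      _ ≤ C.card := by simpa using hdim
  · obtain ⟨a, ha, b, hb, rfl⟩ := W₀.exists_add_mem_mem_orthogonal v
    have ha0 : e i a = 0 := by
      refine hdet a (fun k hk => ?_) i hi
      exact congrFun (show R a = 0 from ha) ⟨k, hk⟩
    have hnorm : ‖b‖ ^ 2 ≤ ‖a + b‖ ^ 2 := by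
      have := norm_add_sq_eq_norm_sq_add_norm_sq_of_inner_eq_zero a b
        (W₀.inner_right_of_mem_orthogonal ha hb)
      nlinarith [mul_self_nonneg ‖a‖]
    have hexp : e i b = ∑ j, inner ℂ (w j) (⟨b, hb⟩ : W₀ᗮ) * e i (w j) := by
      have h := congrArg (fun x : W₀ᗮ => e i (x : H)) (w.sum_repr' ⟨b, hb⟩)
      simpa using h.symm
    have hsq : ∑ j, ‖inner ℂ (w j) (⟨b, hb⟩ : W₀ᗮ)‖ ^ 2 = ‖b‖ ^ 2 :=
      w.sum_sq_norm_inner_right ⟨b, hb⟩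
    rw [map_add, ha0, zero_add, hexp]
    calc ‖∑ j, inner ℂ (w j) (⟨b, hb⟩ : W₀ᗮ) * e i (w j)‖ ^ 2
        ≤ (∑ j, ‖inner ℂ (w j) (⟨b, hb⟩ : W₀ᗮ)‖ * ‖e i (w j)‖) ^ 2 := by
          gcongr
          exact (norm_sum_le _ _).trans_eq (by simp)
      _ ≤ (∑ j, ‖inner ℂ (w j) (⟨b, hb⟩ : W₀ᗮ)‖ ^ 2) * ∑ j, ‖e i (w j)‖ ^ 2 :=
          Finset.sum_mul_sq_le_sq_mul_sq _ _ _
      _ ≤ _ := by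
          rw [hsq, mul_comm]
          gcongr

/-- A solution of a difference equation with a nonvanishing leading coefficient that vanishes on
the boundary of a finite set vanishes on the whole set. -/
theorem eq_zero_of_eq_zero_on_boundary {G ι : Type*} [AddCommGroup G] [Fintype ι]
    (γ : ι → G) (a : ι → G → ℂ) (l : G →+ ℝ) (k₀ : ι) (hl : ∀ k ≠ k₀, l (γ k) < l (γ k₀))
    (ha : ∀ x, a k₀ x ≠ 0) (v : G → ℂ) (hv : ∀ x, ∑ k, a k x * v (x + γ k) = 0)
    (B C : Finset G) (hBC : ∀ b ∈ B, b ∉ C → ∀ k, b + (γ k - γ k₀) ∈ B)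
    (hC : ∀ b ∈ C, v b = 0) : ∀ b ∈ B, v b = 0 := by
  classical
  by_contra! hne
  obtain ⟨b₀, hb₀, hvb₀⟩ := hne
  -- At a nonzero point b with `l` minimal, the equation at b - γ k₀ involves, besides b, only
  -- points of B with smaller `l`, where v is zero.
  obtain ⟨b, hb, hmin⟩ := (B.filter fun b => v b ≠ 0).exists_min_image l
    ⟨b₀, Finset.mem_filter.2 ⟨hb₀, hvb₀⟩⟩
  obtain ⟨hbB, hvb⟩ := Finset.mem_filter.1 hb
  have hbC : b ∉ C := fun h => hvb (hC b h)
  have heq := hv (b - γ k₀)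
  rw [Finset.sum_eq_single_of_mem k₀ (Finset.mem_univ _), sub_add_cancel] at heq
  · exact (mul_ne_zero (ha _) hvb) heq
  · intro k _ hk
    have hmem := hBC b hbB hbC k
    have hshift : b - γ k₀ + γ k = b + (γ k - γ k₀) := by abel
    rw [hshift]
    by_contra h
    have hle := hmin _ (Finset.mem_filter.2 ⟨hmem, right_ne_zero_of_mul h⟩)
    rw [map_add, map_sub] at hle
    linarith [hl k hk]

/-- A vector of maximal norm in a finite family is strictly exposed. -/
theorem exists_inner_lt_inner_self {ι E : Type*} [Finite ι] [Nonempty ι] [NormedAddCommGroup E]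
    [InnerProductSpace ℝ E] (γ : ι → E) (hγ : Function.Injective γ) :
    ∃ k₀, ∀ k ≠ k₀, inner ℝ (γ k₀) (γ k) < inner ℝ (γ k₀) (γ k₀) := by
  obtain ⟨k₀, hk₀⟩ := Finite.exists_max fun k => ‖γ k‖
  refine ⟨k₀, fun k hk => ?_⟩
  have hpos : 0 < ‖γ k₀ - γ k‖ := norm_pos_iff.2 (sub_ne_zero.2 fun h => hk (hγ h.symm))
  have hsq := norm_sub_sq_real (γ k₀) (γ k)
  have hle : ‖γ k‖ ^ 2 ≤ ‖γ k₀‖ ^ 2 := by gcongr; exact hk₀ k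
  rw [real_inner_self_eq_norm_sq]
  nlinarith [pow_pos hpos 2]

/-! ### Følner sets in lattices -/

open Filter Topology Pointwise in
/-- Lattices satisfy the Følner condition. -/
theorem exists_folner {E : Type*} [NormedAddCommGroup E] [InnerProductSpace ℝ E]
    [FiniteDimensional ℝ E] (Γ : Submodule ℤ E) [DiscreteTopology Γ] [IsZLattice ℝ Γ]
    {ι : Type*} [Finite ι] (s : ι → Γ) {ε : ℝ} (hε : 0 < ε) :
    ∃ B C : Finset Γ, B.Nonempty ∧ (∀ b ∈ B, b ∉ C → ∀ k, b + s k ∈ B) ∧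
      (C.card : ℝ) ≤ ε * B.card := by
  classical
  let _ : MeasurableSpace E := borel E
  have : BorelSpace E := ⟨rfl⟩
  obtain ⟨r, hr0, hr⟩ : ∃ r : ℝ, 0 < r ∧ ∀ k, ‖s k‖ ≤ r := by
    obtain ⟨M, hM⟩ := (Set.finite_range fun k => ‖s k‖).bddAbove
    -- The maximum with 1 keeps r positive even if all `s k` vanish, so that the ball has positive
    -- volume.
    exact ⟨max M 1, by positivity, fun k => (hM ⟨k, rfl⟩).trans (le_max_left _ _)⟩
  have hfin (n : ℕ) : {g : Γ | ‖g‖ ≤ n * r}.Finite := by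
    have hc : IsClosed (Γ : Set E) := by
      have : DiscreteTopology Γ.toAddSubgroup := ‹DiscreteTopology Γ›
      exact AddSubgroup.isClosed_of_discrete (H := Γ.toAddSubgroup)
    have h := Metric.finite_isBounded_inter_isClosed (s := (Γ : Set E))
      DiscreteTopology.isDiscrete (Metric.isBounded_closedBall (x := (0 : E)) (r := n * r)) hc
    refine (h.preimage (f := ((↑) : Γ → E)) Subtype.val_injective.injOn).subset fun g hg => ?_
    exact ⟨mem_closedBall_zero_iff.2 hg, g.2⟩
  let B (n : ℕ) : Finset Γ := (hfin n).toFinset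
  have hmemB (n : ℕ) (g : Γ) : g ∈ B n ↔ ‖g‖ ≤ n * r := by simp [B]
  let d := Module.finrank ℝ E
  obtain ⟨c, hc0, hc⟩ : ∃ c : ℝ, 0 < c ∧
      Tendsto (fun n : ℕ => ((B n).card : ℝ) / n ^ d) atTop (𝓝 c) := by
    refine ⟨_, ?_, Tendsto.congr' ?_ (ZLattice.covolume.tendsto_card_div_pow' (L := Γ)
      (s := Metric.closedBall (0 : E) r) Metric.isBounded_closedBall
      Metric.isClosed_closedBall.measurableSet ((convex_closedBall _ _).addHaar_frontier _))⟩
    · refine div_pos ?_ (ZLattice.covolume_pos _ _)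
      exact ENNReal.toReal_pos (Metric.measure_closedBall_pos _ _ hr0).ne'
        (isCompact_closedBall _ _).measure_lt_top.ne
    · filter_upwards [eventually_gt_atTop 0] with n hn
      have hn' : (0 : ℝ) < n := by exact_mod_cast hn
      congr 2
      have himage : Metric.closedBall (0 : E) r ∩ (n : ℝ)⁻¹ • (Γ : Set E) =
          (fun g : Γ => (n : ℝ)⁻¹ • (g : E)) '' (B n : Set Γ) := by
        have hnorm (g : Γ) : ‖(n : ℝ)⁻¹ • (g : E)‖ ≤ r ↔ ‖g‖ ≤ n * r := by
          rw [norm_smul, norm_inv, Real.norm_natCast, inv_mul_le_iff₀ hn', Submodule.coe_norm]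
        ext x
        simp only [Set.mem_inter_iff, mem_closedBall_zero_iff, Set.mem_image,
          Finset.mem_coe, hmemB]
        constructor
        · rintro ⟨hx, g, hg, rfl⟩
          exact ⟨⟨g, hg⟩, (hnorm ⟨g, hg⟩).1 hx, rfl⟩
        · rintro ⟨g, hg, rfl⟩
          exact ⟨(hnorm g).2 hg, g, g.2, rfl⟩
      have hinj : Function.Injective fun g : Γ => (n : ℝ)⁻¹ • (g : E) :=
        (smul_right_injective E (inv_ne_zero hn'.ne')).comp Subtype.val_injective
      rw [himage, Nat.card_coe_set_eq, Set.ncard_image_of_injective _ hinj, Set.ncard_coe_finset]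
  -- Both counts grow like c n ^ d, so the shell between consecutive balls is relatively negligible;
  -- it serves as the boundary C.
  have hratio : Tendsto (fun n : ℕ => ((B n).card : ℝ) / (B (n + 1)).card) atTop (𝓝 1) := by
    have h1 : Tendsto (fun n : ℕ => ((n : ℝ) / (n + 1)) ^ d) atTop (𝓝 1) := by
      simpa using (tendsto_natCast_div_add_atTop (1 : ℝ)).pow d
    have h2 := ((hc.div (hc.comp (tendsto_add_atTop_nat 1)) hc0.ne').mul h1)
    rw [div_self hc0.ne', one_mul] at h2
    refine h2.congr' ?_
    filter_upwards [eventually_gt_atTop 0] with n hn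
    have hn' : (n : ℝ) ≠ 0 := by exact_mod_cast hn.ne'
    have hn'' : (n : ℝ) + 1 ≠ 0 := by positivity
    simp only [Function.comp, Pi.div_apply, Nat.cast_add, Nat.cast_one]
    rw [div_pow]
    field_simp
  obtain ⟨n, hn⟩ := (hratio.eventually (lt_mem_nhds (show 1 - ε < 1 by linarith))).exists
  have hmono : B n ⊆ B (n + 1) := fun g hg => by
    rw [hmemB] at hg ⊢
    refine hg.trans ?_
    gcongr
    simp
  have hne : (B (n + 1)).Nonempty := ⟨0, by rw [hmemB]; simp; positivity⟩
  refine ⟨B (n + 1), B (n + 1) \ B n, hne, fun b hb hbC k => ?_, ?_⟩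
  · have hbn : b ∈ B n := by simpa [hb] using hbC
    rw [hmemB] at hbn ⊢
    push_cast
    linarith [norm_add_le b (s k), hr k]
  · have hpos : (0 : ℝ) < (B (n + 1)).card := by exact_mod_cast hne.card_pos
    rw [Finset.cast_card_sdiff hmono]
    rw [lt_div_iff₀ hpos] at hn
    linarith

/-! ### Square-summable solutions -/

/-- Square-summable solutions of a difference equation have, in total, little relative mass on a
finite set with small boundary. -/
theorem exists_sum_le_card_boundary {G ι : Type*} [AddCommGroup G] [Fintype ι]
    (γ : ι → G) (a : ι → G → ℂ) (l : G →+ ℝ) (k₀ : ι) (hl : ∀ k ≠ k₀, l (γ k) < l (γ k₀))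
    (ha : ∀ x, a k₀ x ≠ 0) (B C : Finset G) (hBC : ∀ b ∈ B, b ∉ C → ∀ k, b + (γ k - γ k₀) ∈ B) :
    ∃ c : G → ℝ≥0∞, ∑ b ∈ B, c b ≤ C.card ∧ ∀ b ∈ B, ∀ v : G → ℂ,
      (∀ x, ∑ k, a k x * v (x + γ k) = 0) → ‖v b‖ₑ ^ 2 / ∑' g, ‖v g‖ₑ ^ 2 ≤ c b := by
  let T (x : G) : lp (fun _ : G => ℂ) 2 →L[ℂ] ℂ :=
    ∑ k, a k x • lp.evalCLM ℂ (fun _ : G => ℂ) 2 (x + γ k)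
  have hT (x : G) (v : lp (fun _ : G => ℂ) 2) : T x v = ∑ k, a k x * v (x + γ k) := by
    simp [T, lp.evalCLM]
  let V : Submodule ℂ (lp (fun _ : G => ℂ) 2) :=
    ⨅ x, LinearMap.ker (T x : lp (fun _ : G => ℂ) 2 →ₗ[ℂ] ℂ)
  have hmemV (v : lp (fun _ : G => ℂ) 2) : v ∈ V ↔ ∀ x, ∑ k, a k x * v (x + γ k) = 0 := by
    simp only [V, Submodule.mem_iInf, ← hT]
    rfl
  have hVclosed : IsClosed (V : Set (lp (fun _ : G => ℂ) 2)) := by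
    simp only [V, Submodule.coe_iInf]
    exact isClosed_iInter fun x => (T x).isClosed_ker
  have : CompleteSpace V := hVclosed.completeSpace_coe
  have heval (i : G) (v : V) :
      (lp.evalCLM ℂ (fun _ : G => ℂ) 2 i ∘L V.subtypeL) v = (v : lp (fun _ : G => ℂ) 2) i := rfl
  obtain ⟨c, hc0, hcsum, hc⟩ := exists_sum_le_card_of_determined
    (fun i : G => lp.evalCLM ℂ (fun _ : G => ℂ) 2 i ∘L V.subtypeL) B C
    (fun v => by
      simp only [heval]
      simpa using lp.sum_rpow_le_norm_rpow (p := 2) (by norm_num) (v : lp (fun _ : G => ℂ) 2) B)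
    (fun v hv => by
      simp only [heval] at hv ⊢
      exact eq_zero_of_eq_zero_on_boundary γ a l k₀ hl ha _ ((hmemV _).1 v.2) B C hBC hv)
  refine ⟨fun b => ENNReal.ofReal (c b), ?_, fun b hb v hv => ?_⟩
  · rw [← ENNReal.ofReal_sum_of_nonneg fun b _ => hc0 b]
    exact (ENNReal.ofReal_le_ofReal hcsum).trans_eq (by simp)
  -- If the total mass is infinite, the quotient is 0 in `ℝ≥0∞`.
  · by_cases htop : ∑' g, ‖v g‖ₑ ^ 2 = ∞
    · simp [htop]
    have hsq (g : G) : ‖v g‖ₑ ^ 2 = ENNReal.ofReal (‖v g‖ ^ 2) := by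
      rw [ENNReal.ofReal_pow (norm_nonneg _), ofReal_norm]
    have hsum : Summable fun g => ‖v g‖ ^ 2 := by
      simpa only [ENNReal.toReal_pow, toReal_enorm] using ENNReal.summable_toReal htop
    have hmem : Memℓp v 2 := memℓp_gen (by simpa using hsum)
    let w : lp (fun _ : G => ℂ) 2 := ⟨v, hmem⟩
    have hw : w ∈ V := (hmemV w).2 hv
    have hnorm : ‖w‖ ^ 2 = ∑' g, ‖v g‖ ^ 2 := by
      simpa using lp.norm_rpow_eq_tsum (p := 2) (by norm_num) w
    have htsum : ∑' g, ‖v g‖ₑ ^ 2 = ENNReal.ofReal (‖w‖ ^ 2) := by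
      rw [hnorm, ENNReal.ofReal_tsum_of_nonneg (fun g => by positivity) hsum]
      simp only [hsq]
    refine ENNReal.div_le_of_le_mul ?_
    rw [htsum, hsq, ← ENNReal.ofReal_mul (hc0 b)]
    exact ENNReal.ofReal_le_ofReal (hc b hb ⟨w, hw⟩)

/-! ### Periodic functions and fundamental domains -/

section Lattice

open scoped Pointwise

variable {E : Type*} [NormedAddCommGroup E] [InnerProductSpace ℝ E] [FiniteDimensional ℝ E]
  [MeasurableSpace E] [BorelSpace E]

instance vaddInvariantMeasure_submodule (L : Submodule ℤ E) :
    VAddInvariantMeasure L E (volume : Measure E) :=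
  inferInstanceAs (VAddInvariantMeasure L.toAddSubgroup E volume)

theorem ae_all_add_of_ae {P : E → Prop} (hP : ∀ᵐ x ∂(volume : Measure E), P x) {ι : Type*}
    [Countable ι] (u : ι → E) : ∀ᵐ x ∂(volume : Measure E), ∀ i, P (x + u i) :=
  ae_all_iff.2 fun i => (measurePreserving_add_right volume (u i)).quasiMeasurePreserving.ae hP

theorem exists_isAddFundamentalDomain (L : Submodule ℤ E) [DiscreteTopology L] [IsZLattice ℝ L] :
    ∃ D : Set E, MeasurableSet D ∧ volume D ≠ ∞ ∧ IsAddFundamentalDomain L D volume := by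
  let b := Module.Free.chooseBasis ℤ L
  exact ⟨ZSpan.fundamentalDomain (b.ofZLatticeBasis ℝ), ZSpan.fundamentalDomain_measurableSet _,
    (ZSpan.fundamentalDomain_isBounded _).measure_lt_top.ne,
    ZLattice.isAddFundamentalDomain b volume⟩

theorem ae_of_ae_restrict_fundamentalDomain {L : Submodule ℤ E} [DiscreteTopology L]
    [IsZLattice ℝ L] {D : Set E} (hD : IsAddFundamentalDomain L D volume)
    (hDm : MeasurableSet D) {P : E → Prop} (hinv : ∀ (g : L) x, P (x + g) ↔ P x)
    (h : ∀ᵐ x ∂(volume.restrict D : Measure E), P x) : ∀ᵐ x ∂(volume : Measure E), P x := by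
  rw [ae_restrict_iff' hDm] at h
  refine hD.measure_zero_of_invariant {x | ¬ P x} (fun g => ?_) ?_
  · ext x
    rw [Set.mem_vadd_set_iff_neg_vadd_mem]
    have := hinv (-g) x
    rw [add_comm] at this
    exact not_congr this
  · refine measure_mono_null (fun x hx => ?_) h
    exact fun hP => hx.1 (hP hx.2)

/-- The translate of D by u is again a fundamental domain, and the integral of a periodic function
does not depend on the domain chosen. -/
theorem setLIntegral_add_right_of_periodic {L : Submodule ℤ E} [DiscreteTopology L]
    [IsZLattice ℝ L] {D : Set E} (hD : IsAddFundamentalDomain L D volume) {H : E → ℝ≥0∞}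
    (hper : ∀ (g : L) x, H (x + g) = H x) (u : E) :
    ∫⁻ x in D, H (x + u) = ∫⁻ x in D, H x := by
  have hD' : IsAddFundamentalDomain L (u +ᵥ D) (volume : Measure E) := hD.vadd_of_comm u
  rw [hD.setLIntegral_eq hD' H fun g x => by
    rw [Submodule.vadd_def, vadd_eq_add, add_comm]; exact hper g x]
  have hpre : (fun x => x + u) ⁻¹' (u +ᵥ D) = D := by
    ext x
    rw [Set.mem_preimage, add_comm, ← vadd_eq_add, Set.vadd_mem_vadd_set_iff]
  conv_lhs => rw [← hpre]
  exact (measurePreserving_add_right volume u).setLIntegral_comp_preimage_emb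
    (MeasurableEquiv.addRight u).measurableEmbedding H _

/-- A periodic function whose averages over suitable finite sets of translates are arbitrarily
small vanishes almost everywhere. -/
theorem ae_eq_zero_of_periodic_of_sum_le (L : Submodule ℤ E) [DiscreteTopology L]
    [IsZLattice ℝ L] {H : E → ℝ≥0∞} (hH : Measurable H) (hper : ∀ (g : L) x, H (x + g) = H x)
    (hsmall : ∀ ε : ℝ, 0 < ε → ∃ B : Finset E, B.Nonempty ∧
      ∀ᵐ x ∂(volume : Measure E), ∑ b ∈ B, H (x + b) ≤ ENNReal.ofReal (ε * B.card)) :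
    ∀ᵐ x ∂(volume : Measure E), H x = 0 := by
  obtain ⟨D, hDm, hDfin, hD⟩ := exists_isAddFundamentalDomain L
  refine ae_of_ae_restrict_fundamentalDomain hD hDm (fun g x => by rw [hper]) ?_
  suffices h : ∫⁻ x in D, H x = 0 from (lintegral_eq_zero_iff hH).1 h
  have hle (ε : NNReal) (hε : 0 < ε) : ∫⁻ x in D, H x ≤ ε * volume D := by
    obtain ⟨B, hB, hle⟩ := hsmall ε hε
    have hB0 : (B.card : ℝ≥0∞) ≠ 0 := by exact_mod_cast hB.card_pos.ne'
    have hsum : B.card * ∫⁻ x in D, H x ≤ B.card * (ε * volume D) := calc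
      B.card * ∫⁻ x in D, H x = ∑ b ∈ B, ∫⁻ x in D, H (x + b) := by
        simp [setLIntegral_add_right_of_periodic hD hper]
      _ = ∫⁻ x in D, ∑ b ∈ B, H (x + b) :=
        (lintegral_finsetSum _ fun b _ => hH.comp (measurable_add_const b)).symm
      _ ≤ ∫⁻ _ in D, ENNReal.ofReal (ε * B.card) :=
        lintegral_mono_ae (ae_restrict_of_ae hle)
      _ = B.card * (ε * volume D) := by
        rw [setLIntegral_const, ENNReal.ofReal_mul ε.coe_nonneg, ENNReal.ofReal_coe_nnreal,
          ENNReal.ofReal_natCast]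
        ring
    exact (ENNReal.mul_le_mul_iff_right hB0 (ENNReal.natCast_ne_top _)).1 hsum
  refine le_antisymm (ENNReal.le_of_forall_pos_le_add fun δ hδ _ => ?_) zero_le
  rw [zero_add]
  obtain ⟨ε, hε, hεD⟩ := ENNReal.exists_nnreal_pos_mul_lt hDfin (ENNReal.coe_ne_zero.2 hδ.ne')
  exact (hle ε hε).trans hεD.le

/-- The restriction of an `L^p` function, `p ≤ 2`, to almost every coset of a lattice is
square-summable. -/
theorem ae_tsum_enorm_sq_ne_top (L : Submodule ℤ E) [DiscreteTopology L] [IsZLattice ℝ L]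
    {p : ℝ≥0∞} (hp_pos : 0 < p) (hp_le : p ≤ 2) {f : E → ℂ} (hf : MemLp f p volume) :
    ∀ᵐ x ∂(volume : Measure E), ∑' g : L, ‖f (x + g)‖ₑ ^ 2 ≠ ∞ := by
  obtain ⟨D, hDm, -, hD⟩ := exists_isAddFundamentalDomain L
  have hp_top : p ≠ ∞ := ne_top_of_le_ne_top (by simp) hp_le
  have hp_real : 0 < p.toReal := ENNReal.toReal_pos hp_pos.ne' hp_top
  have hmeas (g : L) : AEMeasurable (fun x => ‖f (x + g)‖ₑ ^ p.toReal)
      (volume.restrict D : Measure E) :=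
    ((hf.1.comp_measurePreserving
      (measurePreserving_add_right volume (g : E))).enorm.pow_const _).restrict
  -- Unfolding over the translates of D turns this into the integral of |f|^p over the whole space.
  have hint : ∫⁻ x in D, ∑' g : L, ‖f (x + g)‖ₑ ^ p.toReal ≠ ∞ := by
    rw [lintegral_tsum hmeas]
    have h := (lintegral_rpow_enorm_lt_top_of_eLpNorm_lt_top hp_pos.ne' hp_top hf.2).ne
    rw [hD.lintegral_eq_tsum''] at h
    convert h using 6 with g x
    simp [Submodule.vadd_def, add_comm]
  have hae := ae_lt_top' (AEMeasurable.tsum hmeas) hint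
  have hp : ∀ᵐ x ∂(volume : Measure E), ∑' g : L, ‖f (x + g)‖ₑ ^ p.toReal < ∞ := by
    refine ae_of_ae_restrict_fundamentalDomain hD hDm (fun g x => ?_) hae
    rw [← (Equiv.addLeft g).tsum_eq fun g' : L => ‖f (x + g')‖ₑ ^ p.toReal]
    simp [add_assoc]
  filter_upwards [hp] with x hx
  have hsum : Summable fun g : L => ‖f (x + g)‖ ^ p.toReal := by
    simpa [← ENNReal.toReal_rpow] using ENNReal.summable_toReal hx.ne
  -- The inclusion ℓ^p ⊆ ℓ² is where p ≤ 2 enters.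
  have hmem : Memℓp (fun g : L => f (x + g)) 2 := (memℓp_gen hsum).of_exponent_ge hp_le
  have hsq : Summable fun g : L => ‖f (x + g)‖ ^ 2 := by
    simpa using hmem.summable (by norm_num)
  simpa [ENNReal.ofReal_pow, ofReal_norm] using hsq.tsum_ofReal_ne_top

end Lattice

/-! ### Relative mass and conclusion -/

/-- The supremum over the translates of `x` by `L` of the relative mass of `f` at a point of a
`Γ`-orbit. -/
noncomputable def maxRelMass {E : Type*} [AddCommGroup E] (Γ L : Submodule ℤ E) (f : E → ℂ) (x : E) : ℝ≥0∞ :=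
  ⨆ v : L, ‖f (x + v)‖ₑ ^ 2 / ∑' g : Γ, ‖f (x + v + g)‖ₑ ^ 2

theorem maxRelMass_add {E : Type*} [AddCommGroup E] (Γ L : Submodule ℤ E) (f : E → ℂ) (u : L)
    (x : E) : maxRelMass Γ L f (x + u) = maxRelMass Γ L f x := by
  refine Eq.trans ?_ ((Equiv.addLeft u).iSup_comp
    (g := fun v : L => ‖f (x + v)‖ₑ ^ 2 / ∑' g : Γ, ‖f (x + v + g)‖ₑ ^ 2))
  simp [maxRelMass, add_assoc]

/-- Moving by b ∈ Γ stays in the same Γ-orbit, so the total mass in the denominator is unchanged. -/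
theorem maxRelMass_add_le {E : Type*} [AddCommGroup E] {Γ L : Submodule ℤ E} {f : E → ℂ} {x : E}
    {b : Γ} {c : ℝ≥0∞}
    (h : ∀ v : L, ‖f (x + v + b)‖ₑ ^ 2 / ∑' g : Γ, ‖f (x + v + g)‖ₑ ^ 2 ≤ c) :
    maxRelMass Γ L f (x + b) ≤ c := by
  refine iSup_le fun v => ?_
  have hx : x + b + v = x + v + b := by abel
  rw [hx]
  refine le_of_eq_of_le ?_ (h v)
  rw [← (Equiv.addLeft b).tsum_eq fun g : Γ => ‖f (x + v + g)‖ₑ ^ 2]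
  simp [add_assoc]

theorem measurable_maxRelMass {E : Type*} [AddCommGroup E] [MeasurableSpace E] [MeasurableAdd E]
    (Γ L : Submodule ℤ E) [Countable Γ] [Countable L] {f : E → ℂ} (hf : Measurable f) :
    Measurable (maxRelMass Γ L f) := by
  refine Measurable.iSup fun v => ?_
  have h (u : E) : Measurable fun x => ‖f (x + u)‖ₑ ^ 2 :=
    (hf.comp (measurable_add_const u)).enorm.pow_const _
  refine (h v).div (Measurable.tsum fun g => ?_)
  simpa only [add_assoc] using h (v + g)

/-- An `L^p` solution, `p ≤ 2`, of a difference equation along a lattice with almost everywhere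
nonvanishing coefficients that are periodic with respect to another lattice is zero. -/
theorem ae_eq_zero_of_sum_periodic_mul_translate {E ι : Type*} [NormedAddCommGroup E]
    [InnerProductSpace ℝ E] [FiniteDimensional ℝ E] [MeasurableSpace E] [BorelSpace E]
    [Fintype ι] [Nonempty ι]
    (Γ : Submodule ℤ E) [DiscreteTopology Γ] [IsZLattice ℝ Γ]
    (L : Submodule ℤ E) [DiscreteTopology L] [IsZLattice ℝ L]
    (γ : ι → Γ) (hγ : Function.Injective γ) (ψ : ι → E → ℂ)
    (hψ : ∀ k, ∀ v : L, ∀ᵐ x ∂(volume : Measure E), ψ k (x + v) = ψ k x)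
    (hψ_ne : ∀ k, ∀ᵐ x ∂(volume : Measure E), ψ k x ≠ 0)
    {p : ℝ≥0∞} (hp_pos : 0 < p) (hp_le : p ≤ 2) {f : E → ℂ} (hfm : Measurable f)
    (hf : MemLp f p volume)
    (heq : ∀ᵐ x ∂(volume : Measure E), ∑ k, ψ k x * f (x + γ k) = 0) :
    ∀ᵐ x ∂(volume : Measure E), f x = 0 := by
  obtain ⟨k₀, hk₀⟩ := exists_inner_lt_inner_self (fun k => (γ k : E))
    (Subtype.val_injective.comp hγ)
  let l : Γ →+ ℝ := (innerₗ E (γ k₀ : E)).toAddMonoidHom.comp Γ.subtype.toAddMonoidHom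
  have hl : ∀ k ≠ k₀, l (γ k) < l (γ k₀) := hk₀
  have hgood : ∀ᵐ x ∂(volume : Measure E),
      (∀ i : L × Γ, ∑ k, ψ k (x + (i.1 + i.2)) * f (x + (i.1 + i.2) + γ k) = 0) ∧
      (∀ g : Γ, ∀ k, ∀ v : L, ψ k (x + g + v) = ψ k (x + g)) ∧
      ∀ g : Γ, ψ k₀ (x + g) ≠ 0 :=
    (ae_all_add_of_ae heq fun i : L × Γ => (i.1 + i.2 : E)).and <|
      (ae_all_add_of_ae (ae_all_iff.2 fun k => ae_all_iff.2 (hψ k)) fun g : Γ => (g : E)).and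
        (ae_all_add_of_ae (hψ_ne k₀) fun g : Γ => (g : E))
  have hzero : ∀ᵐ x ∂(volume : Measure E), maxRelMass Γ L f x = 0 := by
    refine ae_eq_zero_of_periodic_of_sum_le L (measurable_maxRelMass Γ L hfm)
      (maxRelMass_add Γ L f) fun ε hε => ?_
    obtain ⟨B, C, hB, hBC, hcard⟩ := exists_folner Γ (fun k => γ k - γ k₀) hε
    refine ⟨B.map (Function.Embedding.subtype _), hB.map, ?_⟩
    filter_upwards [hgood] with x ⟨hx_eq, hx_per, hx_ne⟩
    obtain ⟨c, hcsum, hc⟩ := exists_sum_le_card_boundary γ (fun k g => ψ k (x + g)) l k₀ hl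
      hx_ne B C hBC
    rw [Finset.sum_map, Finset.card_map]
    calc ∑ b ∈ B, maxRelMass Γ L f (x + b) ≤ ∑ b ∈ B, c b := by
          refine Finset.sum_le_sum fun b hb => maxRelMass_add_le fun v => ?_
          -- The bound c is fixed before v is chosen: periodicity removes v from the coefficients,
          -- leaving the same equation for every v.
          refine hc b hb (fun g : Γ => f (x + v + g)) fun g => ?_
          rw [← hx_eq (v, g)]
          refine Finset.sum_congr rfl fun k _ => ?_
          rw [← hx_per g k v]
          simp only [Submodule.coe_add, add_left_comm, add_comm]
      _ ≤ C.card := hcsum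
      _ ≤ ENNReal.ofReal (ε * B.card) := by
          rw [← ENNReal.ofReal_natCast]
          exact ENNReal.ofReal_le_ofReal hcard
  filter_upwards [hzero, ae_tsum_enorm_sq_ne_top Γ hp_pos hp_le hf] with x hx hfin
  -- The term v = 0 suffices: its denominator is finite, so its numerator must vanish.
  have h0 := ENNReal.iSup_eq_zero.1 hx 0
  rw [ENNReal.div_eq_zero_iff] at h0
  simpa [hfin] using h0

theorem theorem3p1 {d N : ℕ} (hN : 1 ≤ N)
    (Γ : Submodule ℤ (EuclideanSpace ℝ (Fin d))) [DiscreteTopology Γ] [IsZLattice ℝ Γ]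
    (Λ : Submodule ℤ (EuclideanSpace ℝ (Fin d))) [DiscreteTopology Λ] [IsZLattice ℝ Λ]
    (γ : Fin N → EuclideanSpace ℝ (Fin d)) (hγ : ∀ k, γ k ∈ Γ)
    (hγ_inj : Function.Injective γ)
    (ψ : Fin N → Lp ℂ ∞ (volume : Measure (EuclideanSpace ℝ (Fin d))))
    (hψ : ∀ k, ψ k ∈ periodicLinfty Λ)
    (hψ_ne : ∀ k, ∀ᵐ x ∂(volume : Measure (EuclideanSpace ℝ (Fin d))), ψ k x ≠ 0)
    (p : ℝ≥0∞) (hp_pos : 0 < p) (hp_le : p ≤ 2) :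
    LinearMap.ker (latticeOp p γ ψ) = ⊥ := by
  have : Nonempty (Fin N) := ⟨⟨0, hN⟩⟩
  rw [LinearMap.ker_eq_bot']
  intro f hf
  rw [Lp.eq_zero_iff_ae_eq_zero]
  refine ae_eq_zero_of_sum_periodic_mul_translate Γ Λ (fun k => ⟨γ k, hγ k⟩)
    (fun j k h => hγ_inj (congrArg Subtype.val h)) (fun k => ψ k) (fun k v => ?_) hψ_ne hp_pos
    hp_le (Lp.stronglyMeasurable f).measurable (Lp.memLp f) ?_
  · have h := coeFn_translateLp ∞ (v : EuclideanSpace ℝ (Fin d)) (ψ k)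
    rw [hψ k v v.2] at h
    exact h.symm
  · have h := coeFn_latticeOp p γ ψ f
    rw [hf] at h
    exact h.symm.trans (Lp.coeFn_zero _ _ _)
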